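/- \textbf{Proposition (average- versus worst-case min-entropy for extractors).} Let $n,m,d\in\mathbb{N}$, let $\mathsf{Ext}=\{f_s:[2^n]\to[2^m]\}_{s\in[2^d]}$ be any family of functions, and let $k\in\mathbb{R}$. All operators below act on a finite-dimensional complex Hilbert space $\mathcal{H}$ of arbitrary dimension, $\preceq$ is the Loewner order, and $\|X\|_1=\mathrm{Tr}\sqrt{X^\dagger X}$ is the trace norm. Define the worst-case quantum error $$\mathrm{Err}^*(\mathsf{Ext},k):=\sup\ \frac{1}{2^d}\sum_{i\in[2^n]}\ \sum_{(s,j)\in[2^d]\times[2^m]}\Big[\delta_{f_s(i)=j}-\frac{1}{2^m}\Big]\,\mathrm{Tr}\big[E_i\,\sigma^{1/2}D_{(s,j)}\,\sigma^{1/2}\big]$$ over all $\mathcal{H}$ and all operators $\sigma$, $E_i$, $D_{(s,j)}$ with $\sigma\succeq0$, $\mathrm{Tr}[\sigma]=1$, $0\preceq E_i\preceq 2^{-k}\mathbb{1}$ for all $i$, $\sum_iE_i=\mathbb{1}$, and $0\preceq D_{(s,j)}\preceq\mathbb{1}$ for all $(s,j)$. Define the average-case quantum error $$Q(\mathsf{Ext},k):=\sup\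 \frac12\cdot\frac{1}{2^d}\sum_{(s,j)\in[2^d]\times[2^m]}\Big\|\sum_{i\in[2^n]}\Big[\delta_{f_s(i)=j}-\frac{1}{2^m}\Big]\sigma_i\Big\|_1$$ over all $\mathcal{H}$ and all operators $\sigma_i$, $\omega$ with $\omega\succeq0$, $\mathrm{Tr}[\omega]=1$, $0\preceq\sigma_i\preceq2^{-k}\omega$ for all $i$, and $\sum_i\mathrm{Tr}[\sigma_i]=1$. (A supremum over an empty feasible set is $-\infty$.) Then for every $\varepsilon>0$, $$Q(\mathsf{Ext},k)\ \le\ \mathrm{Err}^*\!\Big(\mathsf{Ext},\,k-\log_2\big(1/\varepsilon^2+1\big)\Big)+\varepsilon .$$ -/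

import Mathlib

open scoped MatrixOrder

noncomputable section

/-- The trace norm `‖X‖₁ = Tr √(X† X)` of a square complex matrix. -/
def traceNorm {r : ℕ} (X : Matrix (Fin r) (Fin r) ℂ) : ℝ :=
  (CFC.sqrt (X.conjTranspose * X)).trace.re

/-- A (seeded) extractor: a family of functions `f_s : [2^n] → [2^m]` indexed by `s ∈ [2^d]`. -/
abbrev Extractor (n m d : ℕ) : Type := Fin (2 ^ d) → Fin (2 ^ n) → Fin (2 ^ m)

/-- The coefficient `δ_{f_s(i) = j} - 2^{-m}`. -/
def extCoeff {n m d : ℕ} (f : Extractor n m d)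
    (i : Fin (2 ^ n)) (s : Fin (2 ^ d)) (j : Fin (2 ^ m)) : ℝ :=
  (if f s i = j then 1 else 0) - 1 / 2 ^ m

/-- Feasible points `(σ, (E_i), (D_{(s,j)}))` on `ℂ^r` of the worst-case quantum program;
matrix inequalities are in the Loewner order. -/
structure WorstCaseFeasible {n m d : ℕ} (k : ℝ) {r : ℕ}
    (σ : Matrix (Fin r) (Fin r) ℂ)
    (E : Fin (2 ^ n) → Matrix (Fin r) (Fin r) ℂ)
    (D : Fin (2 ^ d) → Fin (2 ^ m) → Matrix (Fin r) (Fin r) ℂ) : Prop where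
  state_nonneg : 0 ≤ σ
  state_trace : σ.trace = 1
  source_nonneg : ∀ i, 0 ≤ E i
  source_le : ∀ i, E i ≤ ((2 : ℝ) ^ (-k)) • (1 : Matrix (Fin r) (Fin r) ℂ)
  source_sum : ∑ i, E i = 1
  test_nonneg : ∀ s j, 0 ≤ D s j
  test_le : ∀ s j, D s j ≤ 1

/-- The objective `2^{-d} ∑_{i,(s,j)} [δ_{f_s(i)=j} - 2^{-m}] Tr[E_i σ^{1/2} D_{(s,j)} σ^{1/2}]`. -/
def worstCaseObjective {n m d : ℕ} (f : Extractor n m d) {r : ℕ}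
    (σ : Matrix (Fin r) (Fin r) ℂ)
    (E : Fin (2 ^ n) → Matrix (Fin r) (Fin r) ℂ)
    (D : Fin (2 ^ d) → Fin (2 ^ m) → Matrix (Fin r) (Fin r) ℂ) : ℝ :=
  (1 / 2 ^ d) * ∑ i, ∑ s, ∑ j,
    extCoeff f i s j * (E i * CFC.sqrt σ * D s j * CFC.sqrt σ).trace.re

/-- `Err*(Ext, k)`: the supremum of the objective over all feasible points in all finite
dimensions, in the extended reals (so `⊥` if there is no feasible point). -/
def ErrStar {n m d : ℕ} (f : Extractor n m d) (k : ℝ) : EReal :=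
  sSup {v : EReal | ∃ (r : ℕ) (σ : Matrix (Fin r) (Fin r) ℂ)
    (E : Fin (2 ^ n) → Matrix (Fin r) (Fin r) ℂ)
    (D : Fin (2 ^ d) → Fin (2 ^ m) → Matrix (Fin r) (Fin r) ℂ),
    WorstCaseFeasible k σ E D ∧ v = ((worstCaseObjective f σ E D : ℝ) : EReal)}

/-- Feasible points `((σ_i), ω)` on `ℂ^r` of the average-case quantum program. -/
structure AverageCaseFeasible {n : ℕ} (k : ℝ) {r : ℕ}
    (σ : Fin (2 ^ n) → Matrix (Fin r) (Fin r) ℂ)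
    (ω : Matrix (Fin r) (Fin r) ℂ) : Prop where
  ref_nonneg : 0 ≤ ω
  ref_trace : ω.trace = 1
  nonneg : ∀ i, 0 ≤ σ i
  le_ref : ∀ i, σ i ≤ ((2 : ℝ) ^ (-k)) • ω
  trace_sum : ∑ i, (σ i).trace = 1

/-- The objective `½ · 2^{-d} ∑_{(s,j)} ‖∑_i [δ_{f_s(i)=j} - 2^{-m}] σ_i‖₁`. -/
def averageCaseObjective {n m d : ℕ} (f : Extractor n m d) {r : ℕ}
    (σ : Fin (2 ^ n) → Matrix (Fin r) (Fin r) ℂ) : ℝ :=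
  (1 / 2) * (1 / 2 ^ d) * ∑ s, ∑ j, traceNorm (∑ i, extCoeff f i s j • σ i)

/-- `Q(Ext, k)`: the supremum of the objective over all feasible points in all finite
dimensions, in the extended reals (so `⊥` if there is no feasible point). -/
def QExt {n m d : ℕ} (f : Extractor n m d) (k : ℝ) : EReal :=
  sSup {v : EReal | ∃ (r : ℕ) (σ : Fin (2 ^ n) → Matrix (Fin r) (Fin r) ℂ)
    (ω : Matrix (Fin r) (Fin r) ℂ),
    AverageCaseFeasible k σ ω ∧ v = ((averageCaseObjective f σ : ℝ) : EReal)}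

end

open scoped MatrixOrder ComplexOrder
open Matrix

/-! ### Loewner order, functional calculus and the steering measurement. -/

section MatrixLemmas

variable {r : ℕ}

/-! Mix the source with its reference: `τ = t ∑ σᵢ + u ω`, `t + u = 1`, `u / t = ε²`. Since `t σᵢ ≤
2^(-k) ε⁻² (u ω) ≤ 2^(-k) ε⁻² τ`, the pretty good measurement `τ^(-1/2) (t σᵢ) τ^(-1/2)` has effects
at most `2^(-k) / ε²`. Spreading the missing part of the identity evenly adds at most `2^(-n) ≤
2^(-k)`, whence the factor `1 / ε² + 1` (`exists_measurement`). With the tests optimal for the trace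
norms, the worst-case value is `t` times the average-case value plus `u` times the bias of the
uniform source `2^(-n) ω`. Biases lie in `[-1, 1]` (`abs_extBias_le_one`), so the loss is at most
`2u ≤ ε`. -/

lemma conj_le_conj_of_isHermitian {S A B : Matrix (Fin r) (Fin r) ℂ} (hS : S.IsHermitian)
    (h : A ≤ B) : S * A * S ≤ S * B * S := by
  have h1 := (Matrix.le_iff.mp h).mul_mul_conjTranspose_same S
  rw [hS.eq] at h1
  rw [Matrix.le_iff]
  convert h1 using 1
  noncomm_ring

lemma conj_nonneg_of_isHermitian {S A : Matrix (Fin r) (Fin r) ℂ} (hS : S.IsHermitian)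
    (h : 0 ≤ A) : 0 ≤ S * A * S := by
  simpa using conj_le_conj_of_isHermitian hS h

lemma real_smul_nonneg {A : Matrix (Fin r) (Fin r) ℂ} {c : ℝ} (hc : 0 ≤ c) (h : 0 ≤ A) :
    0 ≤ c • A :=
  (h.posSemidef.smul hc).nonneg

lemma real_smul_le_smul {A B : Matrix (Fin r) (Fin r) ℂ} {c : ℝ} (hc : 0 ≤ c) (h : A ≤ B) :
    c • A ≤ c • B := by
  rw [← sub_nonneg, ← smul_sub]
  exact real_smul_nonneg hc (sub_nonneg.mpr h)

lemma trace_re_nonneg {A : Matrix (Fin r) (Fin r) ℂ} (h : 0 ≤ A) : 0 ≤ A.trace.re :=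
  (Complex.nonneg_iff.mp h.posSemidef.trace_nonneg).1

lemma trace_re_mono {A B : Matrix (Fin r) (Fin r) ℂ} (h : A ≤ B) : A.trace.re ≤ B.trace.re := by
  simpa using trace_re_nonneg (sub_nonneg.mpr h)

lemma trace_re_mul_nonneg {A B : Matrix (Fin r) (Fin r) ℂ} (hA : 0 ≤ A) (hB : 0 ≤ B) :
    0 ≤ (A * B).trace.re := by
  have h := trace_re_nonneg
    (conj_nonneg_of_isHermitian (CFC.sqrt_nonneg B).posSemidef.isHermitian hA)
  rwa [Matrix.trace_mul_comm, ← mul_assoc, CFC.sqrt_mul_sqrt_self B hB,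
    Matrix.trace_mul_comm] at h

lemma trace_re_mul_le {A B : Matrix (Fin r) (Fin r) ℂ} (hA : 0 ≤ A) (hB : B ≤ 1) :
    (A * B).trace.re ≤ A.trace.re := by
  simpa [mul_sub] using trace_re_mul_nonneg hA (sub_nonneg.mpr hB)

/-- `B A B` is the Gram matrix of `√A B`. -/
lemma mul_eq_zero_of_conj_eq_zero {A B : Matrix (Fin r) (Fin r) ℂ} (hA : 0 ≤ A)
    (hB : B.IsHermitian) (h : B * A * B = 0) : A * B = 0 := by
  have hs := (CFC.sqrt_nonneg A).posSemidef.isHermitian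
  have h1 : (CFC.sqrt A * B).conjTranspose * (CFC.sqrt A * B) = 0 := by
    rw [Matrix.conjTranspose_mul, hs.eq, hB.eq, ← h]
    nth_rewrite 3 [← CFC.sqrt_mul_sqrt_self A hA]
    noncomm_ring
  rw [Matrix.conjTranspose_mul_self_eq_zero] at h1
  rw [← CFC.sqrt_mul_sqrt_self A hA, mul_assoc, h1, mul_zero]

/-- The spectrum is finite, so step functions and `x⁻¹` are admissible in `cfc`. -/
lemma continuousOn_spectrum (X : Matrix (Fin r) (Fin r) ℂ) (g : ℝ → ℝ) :
    ContinuousOn g (spectrum ℝ X) :=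
  X.finite_real_spectrum.continuousOn g

/-- The trace norm of a Hermitian matrix is attained on the projector onto its nonnegative
eigenspaces. -/
lemma exists_test_traceNorm_eq {X : Matrix (Fin r) (Fin r) ℂ} (hX : X.IsHermitian) :
    ∃ D : Matrix (Fin r) (Fin r) ℂ, 0 ≤ D ∧ D ≤ 1 ∧
      traceNorm X = 2 * (X * D).trace.re - X.trace.re := by
  have hsa : IsSelfAdjoint X := hX
  let g : ℝ → ℝ := fun x => if 0 ≤ x then 1 else 0
  have hc := continuousOn_spectrum X
  refine ⟨cfc g X, cfc_nonneg fun x _ => ?_, cfc_le_one g X fun x _ => ?_, ?_⟩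
  · dsimp only [g]; split_ifs <;> norm_num
  · dsimp only [g]; split_ifs <;> norm_num
  · have h1 : CFC.sqrt (X.conjTranspose * X) = cfc (fun x : ℝ => |x|) X := by
      refine CFC.sqrt_unique ?_ (cfc_nonneg fun x _ => abs_nonneg x)
      rw [← cfc_mul (fun x : ℝ => |x|) (fun x : ℝ => |x|) X (hc _) (hc _), hX.eq]
      simp only [abs_mul_abs_self]
      rw [cfc_mul (fun x : ℝ => x) (fun x : ℝ => x) X (hc _) (hc _), cfc_id' ℝ X]
    -- Pointwise, `|x| = 2 x g(x) - x`.
    have h2 : cfc (fun x : ℝ => |x|) X = (2 : ℝ) • (X * cfc g X) - X := by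
      have hXg : X * cfc g X = cfc (fun x : ℝ => x * g x) X := by
        rw [cfc_mul (fun x : ℝ => x) g X (hc _) (hc _), cfc_id' ℝ X]
      rw [hXg, ← cfc_const_mul (2 : ℝ) (fun x : ℝ => x * g x) X (hc _)]
      nth_rewrite 3 [← cfc_id' ℝ X]
      rw [← cfc_sub _ _ X (hc _) (hc _)]
      congr 1
      funext x
      dsimp only [g]
      split_ifs with h
      · rw [abs_of_nonneg h]; ring
      · rw [abs_of_neg (not_le.mp h)]; ring
    rw [traceNorm, h1, h2]
    simp

/-- The pseudo-inverse of a Hermitian matrix, with its support projector. -/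
lemma exists_pseudoInverse {S : Matrix (Fin r) (Fin r) ℂ} (hS : S.IsHermitian) :
    ∃ T P : Matrix (Fin r) (Fin r) ℂ, T.IsHermitian ∧ P.IsHermitian ∧ S * T = P ∧ T * S = P ∧
      P * S = S ∧ S * P = S ∧ P ≤ 1 ∧ P * P = P := by
  have hsa : IsSelfAdjoint S := hS
  have hc := continuousOn_spectrum S
  have hid : cfc (fun x : ℝ => x) S = S := cfc_id' ℝ S
  have hm : ∀ g h l : ℝ → ℝ, (∀ x, g x * h x = l x) → cfc g S * cfc h S = cfc l S := by
    intro g h l H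
    rw [← cfc_mul g h S (hc _) (hc _)]
    simp only [H]
  -- As `0⁻¹ = 0`, the function `x * x⁻¹` is the indicator of `x ≠ 0`.
  refine ⟨cfc (fun x : ℝ => x⁻¹) S, cfc (fun x : ℝ => x * x⁻¹) S, cfc_predicate _ S,
    cfc_predicate _ S, ?_, ?_, ?_, ?_, ?_, ?_⟩
  · nth_rewrite 1 [← hid]
    exact hm _ _ _ fun x => rfl
  · nth_rewrite 2 [← hid]
    exact hm _ _ _ fun x => mul_comm _ _
  · nth_rewrite 2 3 [← hid]
    exact hm _ _ _ fun x => mul_inv_mul_cancel x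
  · nth_rewrite 1 3 [← hid]
    exact hm _ _ _ fun x => by rw [mul_comm, mul_inv_mul_cancel]
  · exact cfc_le_one _ S fun x _ => mul_inv_le_one
  · exact hm _ _ _ fun x => by rw [← mul_assoc, mul_inv_mul_cancel]

/-- If `0 ≤ A ≤ S²` and `P` is the support projector of `S`, then `P A P = A`. -/
lemma conj_support_eq {S P A : Matrix (Fin r) (Fin r) ℂ} (hP : P.IsHermitian) (hSP : S * P = S)
    (hA : 0 ≤ A) (hAS : A ≤ S * S) : P * A * P = A := by
  have hQ : (1 - P).IsHermitian := Matrix.isHermitian_one.sub hP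
  have h0 : (1 - P) * A * (1 - P) = 0 := by
    refine le_antisymm ?_ (conj_nonneg_of_isHermitian hQ hA)
    refine (conj_le_conj_of_isHermitian hQ hAS).trans_eq ?_
    simp [mul_sub, mul_assoc, hSP]
  have h1 : A * P = A := by
    have := mul_eq_zero_of_conj_eq_zero hA hQ h0
    rw [mul_sub, mul_one, sub_eq_zero] at this
    exact this.symm
  have h2 : P * A = A := by
    have := congrArg Matrix.conjTranspose h1
    rwa [Matrix.conjTranspose_mul, hP.eq, hA.posSemidef.isHermitian.eq] at this
  rw [h2, h1]

/-- A subnormalised decomposition `∑ aᵢ + b = σ` with `aᵢ ≤ c b` is steered, up to spreading `b`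
uniformly, by a measurement whose effects are at most `c + 1 / N`. -/
lemma exists_measurement {ι : Type*} [Fintype ι] [Nonempty ι]
    {a : ι → Matrix (Fin r) (Fin r) ℂ}
    {b σ : Matrix (Fin r) (Fin r) ℂ} {c : ℝ} (ha : ∀ i, 0 ≤ a i) (hb : 0 ≤ b)
    (hσ : σ = ∑ i, a i + b) (hc : 0 ≤ c) (hab : ∀ i, a i ≤ c • b) :
    ∃ E : ι → Matrix (Fin r) (Fin r) ℂ, (∀ i, 0 ≤ E i) ∧
      (∀ i, E i ≤ (c + (Fintype.card ι : ℝ)⁻¹) • 1) ∧ ∑ i, E i = 1 ∧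
      ∀ i, CFC.sqrt σ * E i * CFC.sqrt σ = a i + (Fintype.card ι : ℝ)⁻¹ • b := by
  have hsum : 0 ≤ ∑ i, a i := Finset.sum_nonneg fun i _ => ha i
  have hσ0 : 0 ≤ σ := hσ ▸ add_nonneg hsum hb
  have hbσ : b ≤ σ := by rw [hσ]; exact le_add_of_nonneg_left hsum
  have haσ : ∀ i, a i ≤ σ := fun i => by
    rw [hσ]
    exact (Finset.single_le_sum (fun i _ => ha i) (Finset.mem_univ i)).trans
      (le_add_of_nonneg_right hb)
  set S := CFC.sqrt σ with hSdef
  have hSS : S * S = σ := CFC.sqrt_mul_sqrt_self σ hσ0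
  obtain ⟨T, P, hT, hP, hST, hTS, hPS, hSP, hP1, hPP⟩ :=
    exists_pseudoInverse (CFC.sqrt_nonneg σ).posSemidef.isHermitian
  have hsupp : ∀ A : Matrix (Fin r) (Fin r) ℂ, 0 ≤ A → A ≤ σ → S * (T * A * T) * S = A := by
    intro A hA hAσ
    calc S * (T * A * T) * S = (S * T) * A * (T * S) := by noncomm_ring
      _ = A := by rw [hST, hTS]; exact conj_support_eq hP hSP hA (hAσ.trans_eq hSS.symm)
  have hTσ : T * σ * T = P := by
    rw [← hSS]
    calc T * (S * S) * T = (T * S) * (S * T) := by noncomm_ring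
      _ = P := by rw [hTS, hST, hPP]
  have hN : (0 : ℝ) < Fintype.card ι := by exact_mod_cast Fintype.card_pos
  have hF0 : 0 ≤ T * (∑ i, a i) * T := conj_nonneg_of_isHermitian hT hsum
  have hF1 : T * (∑ i, a i) * T ≤ 1 := by
    refine le_trans ?_ hP1
    rw [← hTσ]
    refine conj_le_conj_of_isHermitian hT ?_
    rw [hσ]
    exact le_add_of_nonneg_right hb
  -- The remainder is `T b T` plus the projector onto `ker σ`; conjugation by `S` turns it into `b`.
  refine ⟨fun i => T * a i * T + (Fintype.card ι : ℝ)⁻¹ • (1 - T * (∑ i, a i) * T),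
    fun i => ?_, fun i => ?_, ?_, fun i => ?_⟩
  · exact add_nonneg (conj_nonneg_of_isHermitian hT (ha i))
      (real_smul_nonneg (inv_nonneg.mpr hN.le) (sub_nonneg.mpr hF1))
  · rw [add_smul]
    refine add_le_add ?_ (real_smul_le_smul (inv_nonneg.mpr hN.le) (sub_le_self _ hF0))
    refine le_trans (conj_le_conj_of_isHermitian hT
      ((hab i).trans (real_smul_le_smul hc hbσ))) ?_
    rw [mul_smul_comm, smul_mul_assoc, hTσ]
    exact real_smul_le_smul hc hP1
  · rw [Finset.sum_add_distrib, Finset.sum_const, Finset.card_univ, ← Nat.cast_smul_eq_nsmul ℝ,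
      smul_smul, mul_inv_cancel₀ hN.ne', one_smul, Finset.mul_sum, Finset.sum_mul]
    abel
  · have hsum' := hsupp _ hsum (by rw [hσ]; exact le_add_of_nonneg_right hb)
    rw [mul_add, add_mul, hsupp _ (ha i) (haσ i), mul_smul_comm, smul_mul_assoc, mul_sub, sub_mul,
      hsum', mul_one, hSS, hσ, add_sub_cancel_left]

end MatrixLemmas

/-! ### Bias of test probabilities and comparison of the two programs. -/

section Bias

variable {n m d : ℕ}

/-- The averaged bias of an array of test probabilities. -/
noncomputable def extBias (f : Extractor n m d) (x : Fin (2 ^ n) → Fin (2 ^ d) → Fin (2 ^ m) → ℝ) : ℝ :=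
  (1 / 2 ^ d) * ∑ i, ∑ s, ∑ j, extCoeff f i s j * x i s j

lemma sum_extCoeff (f : Extractor n m d) (i : Fin (2 ^ n)) (s : Fin (2 ^ d)) :
    ∑ j, extCoeff f i s j = 0 := by
  simp [extCoeff, Finset.sum_sub_distrib]

/-- For fixed `i` and `s`, the sum over `j` is the value at `f s i` minus the mean over `j`, both in
`[0, y i]`. -/
lemma abs_extBias_le_one (f : Extractor n m d)
    {x : Fin (2 ^ n) → Fin (2 ^ d) → Fin (2 ^ m) → ℝ} {y : Fin (2 ^ n) → ℝ}
    (hx0 : ∀ i s j, 0 ≤ x i s j) (hxy : ∀ i s j, x i s j ≤ y i) (hy : ∑ i, y i = 1) :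
    |extBias f x| ≤ 1 := by
  have hrow : ∀ i s, |∑ j, extCoeff f i s j * x i s j| ≤ y i := by
    intro i s
    have hexp : ∑ j, extCoeff f i s j * x i s j
        = x i s (f s i) - (1 / 2 ^ m) * ∑ j, x i s j := by
      simp [extCoeff, sub_mul, Finset.sum_sub_distrib, Finset.mul_sum]
    have h0 : 0 ≤ (1 / 2 ^ m : ℝ) * ∑ j, x i s j :=
      mul_nonneg (by positivity) (Finset.sum_nonneg fun j _ => hx0 i s j)
    have h1 : (1 / 2 ^ m : ℝ) * ∑ j, x i s j ≤ y i := by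
      have := Finset.sum_le_card_nsmul Finset.univ (fun j => x i s j) (y i) fun j _ => hxy i s j
      simp only [Finset.card_univ, Fintype.card_fin, nsmul_eq_mul, Nat.cast_pow,
        Nat.cast_ofNat] at this
      rw [one_div, inv_mul_le_iff₀ (by positivity)]
      exact this
    rw [hexp, abs_le]
    constructor <;> linarith [hx0 i s (f s i), hxy i s (f s i)]
  have hsum : |∑ i, ∑ s, ∑ j, extCoeff f i s j * x i s j| ≤ 2 ^ d := by
    calc |∑ i, ∑ s, ∑ j, extCoeff f i s j * x i s j|
        ≤ ∑ i, ∑ s : Fin (2 ^ d), y i :=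
          (Finset.abs_sum_le_sum_abs _ _).trans (Finset.sum_le_sum fun i _ =>
            (Finset.abs_sum_le_sum_abs _ _).trans (Finset.sum_le_sum fun s _ => hrow i s))
      _ = 2 ^ d := by simp [← Finset.mul_sum, hy]
  rw [extBias, abs_mul, abs_of_nonneg (by positivity), one_div, inv_mul_le_iff₀ (by positivity),
    mul_one]
  exact hsum

lemma extBias_add_smul (f : Extractor n m d)
    (x y : Fin (2 ^ n) → Fin (2 ^ d) → Fin (2 ^ m) → ℝ) (p q : ℝ) :
    extBias f (fun i s j => p * x i s j + q * y i s j) = p * extBias f x + q * extBias f y := by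
  simp only [extBias, Finset.mul_sum, ← Finset.sum_add_distrib]
  refine Finset.sum_congr rfl fun i _ => Finset.sum_congr rfl fun s _ =>
    Finset.sum_congr rfl fun j _ => by ring

variable {r : ℕ}

/-- The trace-norm error is the bias of an optimal family of tests. -/
lemma exists_tests_averageCaseObjective_eq (f : Extractor n m d)
    {σ : Fin (2 ^ n) → Matrix (Fin r) (Fin r) ℂ} (hσ : ∀ i, 0 ≤ σ i) :
    ∃ D : Fin (2 ^ d) → Fin (2 ^ m) → Matrix (Fin r) (Fin r) ℂ,
      (∀ s j, 0 ≤ D s j) ∧ (∀ s j, D s j ≤ 1) ∧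
      averageCaseObjective f σ = extBias f fun i s j => (σ i * D s j).trace.re := by
  have hX : ∀ s j, (∑ i, extCoeff f i s j • σ i).IsHermitian := fun s j =>
    isSelfAdjoint_sum _ fun i _ =>
      IsSelfAdjoint.smul (IsSelfAdjoint.all _) (hσ i).posSemidef.isHermitian
  choose D hD0 hD1 hD using fun s j => exists_test_traceNorm_eq (hX s j)
  refine ⟨D, hD0, hD1, ?_⟩
  -- The `- Tr X` terms from the optimal tests cancel in the sum over `j`.
  have htr : ∑ s, ∑ j, (∑ i, extCoeff f i s j • σ i).trace.re = 0 := by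
    refine Finset.sum_eq_zero fun s _ => ?_
    simp only [Matrix.trace_sum, Matrix.trace_smul, Complex.re_sum, Complex.smul_re, smul_eq_mul]
    rw [Finset.sum_comm]
    simp [← Finset.sum_mul, sum_extCoeff]
  have hmain : ∑ s, ∑ j, traceNorm (∑ i, extCoeff f i s j • σ i)
      = 2 * ∑ i, ∑ s, ∑ j, extCoeff f i s j * (σ i * D s j).trace.re := by
    simp only [hD, Finset.sum_sub_distrib, htr, sub_zero, ← Finset.mul_sum]
    congr 1
    simp only [Finset.sum_mul, smul_mul_assoc, Matrix.trace_sum, Matrix.trace_smul,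
      Complex.re_sum, Complex.smul_re, smul_eq_mul]
    symm
    rw [Finset.sum_comm]
    exact Finset.sum_congr rfl fun s _ => Finset.sum_comm
  rw [averageCaseObjective, extBias, hmain]
  ring

lemma worstCaseObjective_eq_extBias (f : Extractor n m d) (σ : Matrix (Fin r) (Fin r) ℂ)
    (E : Fin (2 ^ n) → Matrix (Fin r) (Fin r) ℂ)
    (D : Fin (2 ^ d) → Fin (2 ^ m) → Matrix (Fin r) (Fin r) ℂ) :
    worstCaseObjective f σ E D
      = extBias f fun i s j => (CFC.sqrt σ * E i * CFC.sqrt σ * D s j).trace.re := by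
  simp only [worstCaseObjective, extBias]
  refine congrArg _ (Finset.sum_congr rfl fun i _ => Finset.sum_congr rfl fun s _ =>
    Finset.sum_congr rfl fun j _ => ?_)
  rw [Matrix.trace_mul_comm (E i * CFC.sqrt σ * D s j) (CFC.sqrt σ), ← mul_assoc, ← mul_assoc]

/-- In a feasible point of the average-case program the min-entropy is at most `n`. -/
lemma AverageCaseFeasible.inv_le_rpow {k : ℝ} {σ : Fin (2 ^ n) → Matrix (Fin r) (Fin r) ℂ}
    {ω : Matrix (Fin r) (Fin r) ℂ} (h : AverageCaseFeasible k σ ω) :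
    ((2 : ℝ) ^ n)⁻¹ ≤ (2 : ℝ) ^ (-k) := by
  have hle : ∀ i, (σ i).trace.re ≤ (2 : ℝ) ^ (-k) := fun i => by
    have := trace_re_mono (h.le_ref i)
    rwa [Matrix.trace_smul, h.ref_trace, Complex.smul_re, Complex.one_re, smul_eq_mul,
      mul_one] at this
  have hs := Finset.sum_le_card_nsmul Finset.univ _ _ fun i _ => hle i
  rw [← Complex.re_sum, h.trace_sum] at hs
  simp only [Complex.one_re, Finset.card_univ, Fintype.card_fin, nsmul_eq_mul, Nat.cast_pow,
    Nat.cast_ofNat] at hs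
  rwa [inv_le_iff_one_le_mul₀' (by positivity)]

lemma rpow_neg_sub_logb (k : ℝ) {c : ℝ} (hc : 0 < c) :
    (2 : ℝ) ^ (-(k - Real.logb 2 c)) = (2 : ℝ) ^ (-k) * c := by
  rw [neg_sub, sub_eq_neg_add, Real.rpow_add two_pos, Real.rpow_logb two_pos (by norm_num) hc]

/-- Every average-case feasible point yields a worst-case feasible point of smaller min-entropy
whose objective is smaller by at most `ε`. -/
lemma AverageCaseFeasible.exists_worstCaseFeasible (f : Extractor n m d) {k ε : ℝ} (hε : 0 < ε)
    {σ : Fin (2 ^ n) → Matrix (Fin r) (Fin r) ℂ} {ω : Matrix (Fin r) (Fin r) ℂ}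
    (h : AverageCaseFeasible k σ ω) :
    ∃ (τ : Matrix (Fin r) (Fin r) ℂ) (E : Fin (2 ^ n) → Matrix (Fin r) (Fin r) ℂ)
      (D : Fin (2 ^ d) → Fin (2 ^ m) → Matrix (Fin r) (Fin r) ℂ),
      WorstCaseFeasible (k - Real.logb 2 (1 / ε ^ 2 + 1)) τ E D ∧
      averageCaseObjective f σ ≤ worstCaseObjective f τ E D + ε := by
  obtain ⟨D, hD0, hD1, hD⟩ := exists_tests_averageCaseObjective_eq f h.nonneg
  set t : ℝ := 1 / (1 + ε ^ 2) with ht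
  set u : ℝ := ε ^ 2 / (1 + ε ^ 2) with hu
  have ht0 : 0 ≤ t := by positivity
  have hu0 : 0 ≤ u := by positivity
  have htu : t + u = 1 := by rw [ht, hu]; field_simp
  have hrpow : (0 : ℝ) < (2 : ℝ) ^ (-k) := by positivity
  obtain ⟨E, hE0, hE1, hEs, hE⟩ := exists_measurement
    (a := fun i => t • σ i) (b := u • ω) (σ := ∑ i, t • σ i + u • ω)
    (c := (2 : ℝ) ^ (-k) * (1 / ε ^ 2))
    (fun i => real_smul_nonneg ht0 (h.nonneg i)) (real_smul_nonneg hu0 h.ref_nonneg) rfl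
    (by positivity) (fun i => by
      refine (real_smul_le_smul ht0 (h.le_ref i)).trans_eq ?_
      rw [smul_smul, smul_smul]
      congr 1
      rw [ht, hu]
      field_simp)
  set τ := ∑ i, t • σ i + u • ω with hτ
  refine ⟨τ, E, D, ⟨?_, ?_, hE0, fun i => ?_, hEs, hD0, hD1⟩, ?_⟩
  · exact add_nonneg (Finset.sum_nonneg fun i _ => real_smul_nonneg ht0 (h.nonneg i))
      (real_smul_nonneg hu0 h.ref_nonneg)
  · rw [hτ, ← Finset.smul_sum, Matrix.trace_add, Matrix.trace_smul, Matrix.trace_smul,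
      Matrix.trace_sum, h.trace_sum, h.ref_trace, ← add_smul, htu, one_smul]
  · refine (hE1 i).trans ?_
    rw [rpow_neg_sub_logb k (by positivity), ← sub_nonneg, ← sub_smul]
    refine real_smul_nonneg ?_ Matrix.PosSemidef.one.nonneg
    have := h.inv_le_rpow
    simp only [Fintype.card_fin, Nat.cast_pow, Nat.cast_ofNat]
    linarith
  · have hobj : worstCaseObjective f τ E D
        = t * averageCaseObjective f σ
          + u * extBias f fun _ s j => ((2 : ℝ) ^ n)⁻¹ * (ω * D s j).trace.re := by
      rw [worstCaseObjective_eq_extBias, hD, ← extBias_add_smul]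
      congr 1
      funext i s j
      rw [hE]
      simp only [Fintype.card_fin, Nat.cast_pow, Nat.cast_ofNat, add_mul, smul_mul_assoc,
        Matrix.trace_add, Matrix.trace_smul, Complex.add_re, Complex.smul_re, smul_eq_mul]
      ring
    have hq : averageCaseObjective f σ ≤ 1 := by
      rw [hD]
      refine (abs_le.mp (abs_extBias_le_one f (y := fun i => (σ i).trace.re)
        (fun i s j => trace_re_mul_nonneg (h.nonneg i) (hD0 s j))
        (fun i s j => trace_re_mul_le (h.nonneg i) (hD1 s j)) ?_)).2
      rw [← Complex.re_sum, h.trace_sum, Complex.one_re]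
    have hv := (abs_le.mp (abs_extBias_le_one f (y := fun _ => ((2 : ℝ) ^ n)⁻¹)
      (x := fun _ s j => ((2 : ℝ) ^ n)⁻¹ * (ω * D s j).trace.re)
      (fun i s j => mul_nonneg (by positivity) (trace_re_mul_nonneg h.ref_nonneg (hD0 s j)))
      (fun i s j => mul_le_of_le_one_right (by positivity)
        ((trace_re_mul_le h.ref_nonneg (hD1 s j)).trans (by simp [h.ref_trace])))
      (by simp))).1
    -- Equivalent to `ε (ε - 1)² ≥ 0`.
    have h2u : 2 * u ≤ ε := by
      rw [hu, ← mul_div_assoc, div_le_iff₀ (by positivity)]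
      nlinarith [mul_nonneg hε.le (sq_nonneg (ε - 1))]
    have ht1 : t = 1 - u := by linarith
    rw [hobj, ht1]
    nlinarith [mul_le_mul_of_nonneg_left hq hu0, mul_le_mul_of_nonneg_left hv hu0]

end Bias

theorem mainTheorem6 (n m d : ℕ) (Ext : Extractor n m d) (k ε : ℝ) (hε : 0 < ε) :
    QExt Ext k ≤ ErrStar Ext (k - Real.logb 2 (1 / ε ^ 2 + 1)) + ((ε : ℝ) : EReal) := by
  refine sSup_le ?_
  rintro v ⟨r, σ, ω, h, rfl⟩
  obtain ⟨τ, E, D, hfeas, hle⟩ := h.exists_worstCaseFeasible Ext hε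
  calc ((averageCaseObjective Ext σ : ℝ) : EReal)
      ≤ ((worstCaseObjective Ext τ E D : ℝ) : EReal) + ((ε : ℝ) : EReal) := by exact_mod_cast hle
    _ ≤ _ := by
      gcongr
      exact le_sSup ⟨r, τ, E, D, hfeas, rfl⟩
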